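/- **Characterisation of compressibility.** *Model.* For each $n$ consider a feedforward network with $L$ hidden layers and widths $p_0=d_{\mathrm{in}},p_1,\dots,p_L,p_{L+1}=d_{\mathrm{out}}\ge 1$ (all depending on $n$, which we suppress). The weight from node $j$ of layer $l$ to node $k$ of layer $l+1$ is $W^{(l+1)}_{jk}=\sqrt{\lambda^{(l)}_{p_l,j}}\,V^{(l+1)}_{jk}$ for $0\le l\le L$, where $\lambda^{(0)}_{p_0,j}=1/d_{\mathrm{in}}$, and where, for $1\le l\le L$, $\lambda^{(l)}_{p_l,j}\sim\mu^{(l)}_{p_l}$ with $\mu^{(l)}_{p_l}$ a probability distribution on $[0,\infty)$. Moreover $V^{(l+1)}_{jk}\sim\mathcal N(0,\sigma_v^2)$ with $\sigma_v>0$, the biases are $\mathcal N(0,\sigma_b^2)$ with $\sigma_b\ge 0$, and for each $n$ all the $\lambda$'s, $V$'s and biases are independent. Fix a layer $l$ with $1\le l\le L$ and let $p_l\to\infty$ as $n\to\infty$ (the other widths may be fixed or vary with $n$ in any way). Put $S:=\sum_{j=1}^{p_l}\lambda^{(l)}_{p_l,j}$ and assume that $S$ converges in distribution to $\Lambda^{(l)}\sim\mathrm{ID}(a^{(l)},\rho^{(l)})$,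 the law on $[0,\infty)$ with Laplace transform $$t\mapsto\exp\Big(-ta^{(l)}-\int_0^\infty(1-e^{-wt})\,\rho^{(l)}(dw)\Big),\qquad t\ge 0,$$ where $a^{(l)}\ge 0$ and $\rho^{(l)}$ is a Borel measure on $(0,\infty)$ with $\int\min(1,x)\,\rho^{(l)}(dx)<\infty$. *Shares.* For nonnegative $x=(x_1,\dots,x_q)$ with decreasing rearrangement $x_{(1)}\ge\dots\ge x_{(q)}$ and $\kappa\in(0,1)$, let $$R_\kappa(x)=\frac{\sum_{j=1}^q\mathbf 1_{\{x_j\le x_{(\lfloor\kappa q\rfloor)}\}}x_j}{\sum_{j=1}^q x_j},\qquad\text{with } R_\kappa(x)=0\text{ if }\sum_{j=1}^q x_j=0,$$ and $x_{(0)}:=0$. Let $T_j=\sum_{k=1}^{p_{l+1}}(W^{(l+1)}_{jk})^2$ be the squared $\ell^2$-norm of the outgoing weights of node $j$ of layer $l$, and write $\lambda=(\lambda^{(l)}_{p_l,j})_{1\le j\le p_l}$ and $T=(T_j)_{1\le j\le p_l}$. Layer $l$ is called $\ell^2$-norm-compressible if $R_\kappa(T)\to 0$ in probability for every $\kappa\in(0,1)$.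 *Theorem.* Suppose that $a^{(l)}=0$. 1. For every $\kappa\in(0,1)$, $\delta>0$ and $\varepsilon>0$, $$\Pr\big(S\ge\delta,\ R_\kappa(\lambda)\ge\varepsilon\big)\to 0\qquad\text{and}\qquad\Pr\big(S\ge\delta,\ R_\kappa(T)\ge\varepsilon\big)\to 0 .$$ 2. Suppose in addition that $\rho^{(l)}$ is infinite (so that $\Lambda^{(l)}>0$ almost surely) or, more generally, that $$\lim_{\delta\downarrow 0}\limsup_{n\to\infty}\Pr(0<S\le\delta)=0 .$$ Then $R_\kappa(\lambda)\to 0$ in probability for every $\kappa\in(0,1)$, and layer $l$ is $\ell^2$-norm-compressible. -/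

import Mathlib

open MeasureTheory ProbabilityTheory Filter Topology
open scoped NNReal ENNReal

noncomputable section

/-- Lévy measures on `(0, ∞)`: Borel measures `ρ` on the line carried by `(0, ∞)` with
`∫ min(1, x) ρ(dx) < ∞`. -/
structure IsLevyMeasure (ρ : Measure ℝ) : Prop where
  carrier : ρ (Set.Iic 0) = 0
  lintegral_lt_top : ∫⁻ x, ENNReal.ofReal (min 1 x) ∂ρ < ∞

/-- `ν` is the infinitely divisible law `ID(a, ρ)` on `[0, ∞)`, i.e. the law with Laplace transform
`t ↦ exp (-t a - ∫ (1 - exp (-w t)) ρ(dw))`. -/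
structure IsID (a : ℝ) (ρ : Measure ℝ) (ν : Measure ℝ) : Prop where
  isProbabilityMeasure : IsProbabilityMeasure ν
  carrier : ν (Set.Iio 0) = 0
  location_nonneg : 0 ≤ a
  levy : IsLevyMeasure ρ
  laplace : ∀ t : ℝ, 0 ≤ t →
    ∫ x, Real.exp (-t * x) ∂ν = Real.exp (-t * a - ∫ w, (1 - Real.exp (-w * t)) ∂ρ)

/-- The random parameters of a feedforward network with widths `p 0 = d_in, p 1, …, p L` and
`p (L + 1) = d_out`, with nodes of each layer numbered from `0`:
`nodeVar l j` is the variance parameter `λ^(l)_j` of node `j` of layer `l`,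
`gauss l j k` is the Gaussian factor `V^(l+1)_{jk}` between node `j` of layer `l` and node `k` of
layer `l + 1`, and `bias l k` is the bias `B^(l+1)_k` of node `k` of layer `l + 1`. -/
structure MixtureNetwork (p : ℕ → ℕ) (Ω : Type*) where
  nodeVar : (l : ℕ) → Fin (p l) → Ω → ℝ
  gauss : (l : ℕ) → Fin (p l) → Fin (p (l + 1)) → Ω → ℝ
  bias : (l : ℕ) → Fin (p (l + 1)) → Ω → ℝ

/-- Labels of the random parameters of a network with `L` hidden layers. -/
inductive ParamIndex (L : ℕ) (p : ℕ → ℕ) : Type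
  | nodeVar (l : ℕ) (h₁ : 1 ≤ l) (h₂ : l ≤ L) (j : Fin (p l)) : ParamIndex L p
  | gauss (l : ℕ) (h : l ≤ L) (j : Fin (p l)) (k : Fin (p (l + 1))) : ParamIndex L p
  | bias (l : ℕ) (h : l ≤ L) (k : Fin (p (l + 1))) : ParamIndex L p

namespace MixtureNetwork

variable {p : ℕ → ℕ} {Ω : Type*}

/-- The random parameter with a given label. -/
def param (N : MixtureNetwork p Ω) (L : ℕ) : ParamIndex L p → Ω → ℝ
  | .nodeVar l _ _ j => N.nodeVar l j
  | .gauss l _ j k => N.gauss l j k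
  | .bias l _ k => N.bias l k

/-- The weight `W^(l+1)_{jk} = √(λ^(l)_j) V^(l+1)_{jk}` from node `j` of layer `l` to node `k` of
layer `l + 1`. -/
def weight (N : MixtureNetwork p Ω) (l : ℕ) (j : Fin (p l)) (k : Fin (p (l + 1))) (ω : Ω) : ℝ :=
  √(N.nodeVar l j ω) * N.gauss l j k ω

/-- The squared `ℓ²`-norm `T^(l+1)_j` of the weights going out of node `j` of layer `l`. -/
def outNormSq (N : MixtureNetwork p Ω) (l : ℕ) (j : Fin (p l)) (ω : Ω) : ℝ :=
  ∑ k, N.weight l j k ω ^ 2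

/-- The total variance parameter `∑ⱼ λ^(l)_j` of layer `l`. -/
def totalVar (N : MixtureNetwork p Ω) (l : ℕ) (ω : Ω) : ℝ :=
  ∑ j, N.nodeVar l j ω

/-- The distributional assumptions on a network with `L` hidden layers: `λ^(0)_j = 1 / d_in`,
`λ^(l)_j ∼ μ l` on `[0, ∞)` for `1 ≤ l ≤ L`, centred Gaussian `V` with standard deviation `σv`,
centred Gaussian biases with standard deviation `σb` (almost surely zero if `σb = 0`), and all of
these parameters independent. -/
structure HasDistribution [MeasurableSpace Ω] (N : MixtureNetwork p Ω) (L : ℕ)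
    (μ : ℕ → Measure ℝ) (σv σb : ℝ≥0) (P : Measure Ω) : Prop where
  width_pos : ∀ l, l ≤ L + 1 → 1 ≤ p l
  nodeVar_zero : ∀ j ω, N.nodeVar 0 j ω = 1 / (p 0 : ℝ)
  nodeVar_carrier : ∀ l, 1 ≤ l → l ≤ L → μ l (Set.Iio 0) = 0
  nodeVar_law : ∀ l, 1 ≤ l → l ≤ L → ∀ j, HasLaw (N.nodeVar l j) (μ l) P
  gauss_law : ∀ l, l ≤ L → ∀ j k, HasLaw (N.gauss l j k) (gaussianReal 0 (σv ^ 2)) P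
  bias_law : ∀ l, l ≤ L → ∀ k, HasLaw (N.bias l k) (gaussianReal 0 (σb ^ 2)) P
  indep : iIndepFun (N.param L) P

end MixtureNetwork

/-- The `k`-th largest value `x_(k)` among `x 0, …, x (q - 1)`, for `1 ≤ k ≤ q`, where
`x_(1) ≥ x_(2) ≥ … ≥ x_(q)`; by convention `0` for other `k`. -/
def orderStat {q : ℕ} (x : Fin q → ℝ) (k : ℕ) : ℝ :=
  if h : 1 ≤ k ∧ k ≤ q then x (Tuple.sort (OrderDual.toDual ∘ x) ⟨k - 1, by omega⟩) else 0

theorem orderStat_antitone {q : ℕ} (x : Fin q → ℝ) {i j : ℕ} (hi : 1 ≤ i) (hij : i ≤ j)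
    (hj : j ≤ q) : orderStat x j ≤ orderStat x i := by
  have h := Tuple.monotone_sort (OrderDual.toDual ∘ x)
  have h' := @h ⟨i - 1, by omega⟩ ⟨j - 1, by omega⟩ (by simp [Fin.le_def]; omega)
  rw [orderStat, orderStat, dif_pos ⟨by omega, hj⟩, dif_pos ⟨hi, by omega⟩]
  exact h'

/-- The share of `∑ⱼ xⱼ` coming from the indices with `xⱼ ≤ x_(⌊κ q⌋)`, with value `0` if
`∑ⱼ xⱼ = 0`. -/
def lowerShare {q : ℕ} (κ : ℝ) (x : Fin q → ℝ) : ℝ :=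
  (∑ j, if x j ≤ orderStat x ⌊κ * q⌋₊ then x j else 0) / ∑ j, x j

/-- Layer `l` of a sequence of networks is `ℓ²`-norm-compressible: for every `κ ∈ (0, 1)` the share
of the squared `ℓ²`-norms of the outgoing weights of its nodes that lies at or below their
`⌊κ p_l⌋`-th order statistic tends to `0` in probability. -/
def IsNormCompressible {Ω : Type*} [MeasurableSpace Ω] (P : Measure Ω) {p : ℕ → ℕ → ℕ}
    (N : (n : ℕ) → MixtureNetwork (p n) Ω) (l : ℕ) : Prop :=
  ∀ κ ∈ Set.Ioo (0 : ℝ) 1,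
    TendstoInMeasure P (fun n ω => lowerShare κ fun j => (N n).outNormSq l j ω) atTop fun _ => 0

end

noncomputable section

/-! ### Order statistics and lower shares -/

/-! Let `G = ∑ⱼ (1 - exp (-t xⱼ))`. Since `1 - exp (-y)` is comparable to `min 1 y`, at most `2G`
entries exceed `1/t`, and the entries at or below `1/t` sum to at most `2G/t`. Hence, once `2G <
⌊κq⌋`, the lower share times the total is at most `2G/t` (`lowerShare_mul_sum_le`).

For the node variances, independence gives `E G ≤ -log E exp (-tS)`, which converges to the Laplace
exponent `ψ(t)` because `a = 0`. Without drift `ψ(t)/t → 0`, so Markov's inequality, with `t` chosen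
large and then `n → ∞`, gives the first claim (`tendsto_measureReal_lowerShare`).

For the outgoing norms, divide `Tⱼ` by its conditional mean factor `σv² p_{l+1}`. Jensen's
inequality shows that this mixing does not increase `E G`
(`integral_one_sub_exp_gaussian_mixture_le`), and the normalised total is rarely small when `S ≥ δ`
(`measureReal_gaussian_mixture_total_lt_le`).

The second part adds that `0 < S ≤ δ` is asymptotically unlikely for small `δ`, and that all shares
are `0` when `S = 0`. For infinite `ρ` the former holds because `ψ(t) → ∞`. -/

theorem card_lt_of_orderStat {q : ℕ} (x : Fin q → ℝ) {h : ℝ} (h0 : 0 ≤ h) {k : ℕ}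
    (hk : h < orderStat x k) : k ≤ (Finset.univ.filter fun j => h < x j).card := by
  by_cases hkq : 1 ≤ k ∧ k ≤ q
  · let f : Fin k → Fin q := fun i =>
      Tuple.sort (OrderDual.toDual ∘ x) ⟨i, i.2.trans_le hkq.2⟩
    have hf : Function.Injective f := by
      intro i j hij
      have := (Tuple.sort (OrderDual.toDual ∘ x)).injective hij
      simpa [Fin.ext_iff] using this
    have := Finset.card_le_card_of_injOn (s := Finset.univ)
      (t := Finset.univ.filter fun j => h < x j) f (fun i _ => ?_) hf.injOn
    · simpa using this
    · have h1 := orderStat_antitone x (i := i + 1) (j := k) (by omega) (by omega) hkq.2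
      have h2 : orderStat x (i + 1) = x (f i) := by
        rw [orderStat, dif_pos ⟨by omega, by omega⟩]
        rfl
      simpa using (hk.trans_le h1).trans_eq h2
  -- Outside the range the default value `0` cannot exceed `h ≥ 0`; this covers `⌊κ q⌋ = 0`.
  · rw [orderStat, dif_neg hkq] at hk
    linarith

theorem orderStat_const_mul {q : ℕ} {c : ℝ} (hc : 0 ≤ c) (x : Fin q → ℝ) (k : ℕ) :
    orderStat (fun j => c * x j) k = c * orderStat x k := by
  unfold orderStat
  split_ifs with h
  · have h1 : Monotone ((OrderDual.toDual ∘ fun j => c * x j) ∘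
        Tuple.sort (OrderDual.toDual ∘ x)) := by
      intro i j hij
      have := Tuple.monotone_sort (OrderDual.toDual ∘ x) hij
      exact mul_le_mul_of_nonneg_left (a := c) this hc
    have h2 := congrFun (Tuple.comp_sort_eq_comp_iff_monotone.2 h1) ⟨k - 1, by omega⟩
    exact h2.symm
  · simp

theorem lowerShare_const_mul {q : ℕ} (κ : ℝ) {c : ℝ} (hc : 0 < c) (x : Fin q → ℝ) :
    lowerShare κ (fun j => c * x j) = lowerShare κ x := by
  unfold lowerShare
  simp only [orderStat_const_mul hc.le, mul_le_mul_iff_right₀ hc]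
  rw [← Finset.mul_sum]
  simp_rw [← mul_ite_zero]
  rw [← Finset.mul_sum, mul_div_mul_left _ _ hc.ne']

theorem lowerShare_of_forall_eq_zero {q : ℕ} (κ : ℝ) {x : Fin q → ℝ} (hx : ∀ j, x j = 0) :
    lowerShare κ x = 0 := by
  simp [lowerShare, hx]

theorem lowerShare_nonneg {q : ℕ} (κ : ℝ) {x : Fin q → ℝ} (hx : ∀ j, 0 ≤ x j) :
    0 ≤ lowerShare κ x :=
  div_nonneg (Finset.sum_nonneg fun j _ => by split_ifs <;> simp [hx])
    (Finset.sum_nonneg fun j _ => hx j)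

/-- A consequence of `exp (-y) ≤ 1 / (1 + y)`. It lets one exponential sum both count the large
entries and dominate the sum of the small ones. -/
theorem half_min_le_one_sub_exp_neg {y : ℝ} (hy : 0 ≤ y) : min 1 y / 2 ≤ 1 - Real.exp (-y) := by
  have h1 : Real.exp (-y) ≤ 1 / (1 + y) := by
    rw [Real.exp_neg, inv_eq_one_div]
    exact one_div_le_one_div_of_le (by linarith) (by linarith [Real.add_one_le_exp y])
  have h2 : 1 / (1 + y) ≤ 1 - min 1 y / 2 := by
    rw [div_le_iff₀ (by linarith)]
    rcases min_cases 1 y with ⟨h, h'⟩ | ⟨h, h'⟩ <;> rw [h] <;> nlinarith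
  linarith

/-- Either many entries exceed the level `h`, or the lower share is carried by the entries below
`h`; both are controlled by `∑ⱼ (1 - exp (-xⱼ / h))`. -/
theorem lowerShare_mul_sum_le {q : ℕ} {κ : ℝ} {x : Fin q → ℝ} (hx : ∀ j, 0 ≤ x j)
    {h : ℝ} (h0 : 0 < h)
    (hk : 2 * ∑ j, (1 - Real.exp (-h⁻¹ * x j)) < ⌊κ * q⌋₊) :
    lowerShare κ x * ∑ j, x j ≤ 2 * h * ∑ j, (1 - Real.exp (-h⁻¹ * x j)) := by
  have hy : ∀ j, min 1 (h⁻¹ * x j) ≤ 2 * (1 - Real.exp (-h⁻¹ * x j)) := fun j => by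
    have := half_min_le_one_sub_exp_neg (mul_nonneg (inv_nonneg.2 h0.le) (hx j))
    rw [neg_mul]
    linarith
  -- Each entry above `h` contributes at least `1/2` to the exponential sum, so fewer than `⌊κ q⌋`
  -- entries exceed `h`.
  have hord : orderStat x ⌊κ * q⌋₊ ≤ h := by
    by_contra! hlt
    have h1 := card_lt_of_orderStat x h0.le hlt
    have h2 : ((Finset.univ.filter fun j => h < x j).card : ℝ) ≤
        2 * ∑ j, (1 - Real.exp (-h⁻¹ * x j)) := by
      rw [Finset.card_filter, Nat.cast_sum, Finset.mul_sum]
      refine Finset.sum_le_sum fun j _ => ?_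
      refine le_trans ?_ (hy j)
      have hpos := mul_nonneg (inv_nonneg.2 h0.le) (hx j)
      split_ifs with hj
      · have : 1 ≤ h⁻¹ * x j := by
          rw [inv_mul_eq_div, one_le_div h0]
          exact hj.le
        simp [this]
      · simpa using hpos
    have h3 : ((⌊κ * q⌋₊ : ℕ) : ℝ) ≤ (Finset.univ.filter fun j => h < x j).card := by
      exact_mod_cast h1
    linarith
  -- Every entry counted here is at most `h`, hence equals `h * min 1 (h⁻¹ * x j)`.
  have hnum : (∑ j, if x j ≤ orderStat x ⌊κ * q⌋₊ then x j else 0) ≤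
      2 * h * ∑ j, (1 - Real.exp (-h⁻¹ * x j)) := by
    rw [Finset.mul_sum]
    refine Finset.sum_le_sum fun j _ => ?_
    have hj := mul_le_mul_of_nonneg_left (hy j) h0.le
    have hpos := mul_nonneg (inv_nonneg.2 h0.le) (hx j)
    split_ifs with hle
    · have h1 : h⁻¹ * x j ≤ 1 := by
        rw [inv_mul_eq_div, div_le_one h0]
        exact hle.trans hord
      rw [min_eq_right h1, mul_inv_cancel_left₀ h0.ne'] at hj
      linarith
    · have := mul_nonneg h0.le (le_min zero_le_one hpos)
      linarith
  refine le_trans ?_ hnum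
  unfold lowerShare
  rcases eq_or_ne (∑ j, x j) 0 with hs | hs
  · rw [hs, mul_zero]
    exact Finset.sum_nonneg fun j _ => by split_ifs <;> simp [hx]
  · rw [div_mul_cancel₀ _ hs]

/-! ### The Laplace exponent of a Lévy measure -/

/-- The Laplace exponent `t ↦ ∫ (1 - exp (-w t)) ρ(dw)`. -/
def laplaceExponent (ρ : Measure ℝ) (t : ℝ) : ℝ := ∫ w, (1 - Real.exp (-w * t)) ∂ρ

theorem one_sub_exp_neg_le_min {y : ℝ} : 1 - Real.exp (-y) ≤ min 1 y :=
  le_min (by linarith [Real.exp_pos (-y)]) (by linarith [Real.add_one_le_exp (-y)])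

namespace IsLevyMeasure

variable {ρ : Measure ℝ}

theorem ae_pos (hρ : IsLevyMeasure ρ) : ∀ᵐ w ∂ρ, 0 < w := by
  rw [ae_iff]
  simpa [Set.Iic] using hρ.carrier

theorem integrable_min (hρ : IsLevyMeasure ρ) : Integrable (fun w => min 1 w) ρ := by
  refine ⟨by fun_prop, ?_⟩
  rw [hasFiniteIntegral_iff_ofReal]
  · exact hρ.lintegral_lt_top
  · filter_upwards [hρ.ae_pos] with w hw
    exact le_min zero_le_one hw.le

/-- Dominated convergence: for `t ≥ 1` the integrand lies below `min 1 w`, and pointwise below `1 /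
t`. This sublinearity is what distinguishes zero drift: the full exponent of `ID(a, ρ)` divided by
`t` tends to `a`. -/
theorem tendsto_laplaceExponent_div (hρ : IsLevyMeasure ρ) :
    Tendsto (fun t => laplaceExponent ρ t / t) atTop (𝓝 0) := by
  have h : Tendsto (fun t : ℝ => ∫ w, (1 - Real.exp (-w * t)) / t ∂ρ) atTop
      (𝓝 (∫ _, (0 : ℝ) ∂ρ)) := by
    refine tendsto_integral_filter_of_dominated_convergence (fun w => min 1 w)
      (.of_forall fun t => by fun_prop) ?_ hρ.integrable_min ?_
    · filter_upwards [eventually_ge_atTop 1] with t ht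
      filter_upwards [hρ.ae_pos] with w hw
      have hwt : 0 ≤ w * t := by positivity
      have h1 : Real.exp (-w * t) ≤ 1 := Real.exp_le_one_iff.2 (by linarith)
      rw [Real.norm_of_nonneg (div_nonneg (by linarith) (by linarith)),
        div_le_iff₀ (by linarith), neg_mul]
      refine one_sub_exp_neg_le_min.trans ?_
      rw [min_mul_of_nonneg _ _ (by linarith)]
      exact min_le_min (by linarith) le_rfl
    · filter_upwards [hρ.ae_pos] with w hw
      refine squeeze_zero' ?_ ?_ (tendsto_inv_atTop_zero (𝕜 := ℝ))
      · filter_upwards [eventually_gt_atTop 0] with t ht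
        have : Real.exp (-w * t) ≤ 1 := Real.exp_le_one_iff.2 (by nlinarith)
        exact div_nonneg (by linarith) ht.le
      · filter_upwards [eventually_gt_atTop 0] with t ht
        rw [← one_div]
        gcongr
        linarith [Real.exp_pos (-w * t)]
  simpa [integral_div, laplaceExponent] using h

/-- Monotone convergence of the integrands to `1`, so the exponents increase to the total mass of
`ρ`. -/
theorem tendsto_laplaceExponent_atTop (hρ : IsLevyMeasure ρ) (htop : ρ Set.univ = ∞) :
    Tendsto (fun n : ℕ => laplaceExponent ρ n) atTop atTop := by
  have h1 : Tendsto (fun n : ℕ => ∫⁻ w, ENNReal.ofReal (1 - Real.exp (-w * n)) ∂ρ) atTop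
      (𝓝 (∫⁻ _, 1 ∂ρ)) := by
    refine lintegral_tendsto_of_tendsto_of_monotone (fun n => by fun_prop) ?_ ?_
    · filter_upwards [hρ.ae_pos] with w hw m n hmn
      refine ENNReal.ofReal_le_ofReal (sub_le_sub_left (Real.exp_le_exp.2 ?_) _)
      have : (m : ℝ) ≤ n := by exact_mod_cast hmn
      nlinarith
    · filter_upwards [hρ.ae_pos] with w hw
      have : Tendsto (fun n : ℕ => Real.exp (-w * n)) atTop (𝓝 0) :=
        Real.tendsto_exp_atBot.comp
          (tendsto_natCast_atTop_atTop.const_mul_atTop_of_neg (neg_neg_of_pos hw))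
      simpa using ENNReal.tendsto_ofReal (this.const_sub 1)
  have h2 : ∀ n : ℕ, ∫⁻ w, ENNReal.ofReal (1 - Real.exp (-w * n)) ∂ρ =
      ENNReal.ofReal (laplaceExponent ρ n) := fun n => by
    have hnn : ∀ᵐ w ∂ρ, 0 ≤ 1 - Real.exp (-w * n) := by
      filter_upwards [hρ.ae_pos] with w hw
      have : Real.exp (-w * n) ≤ 1 := Real.exp_le_one_iff.2 (by
        have : (0 : ℝ) ≤ w * n := by positivity
        linarith)
      linarith
    rw [laplaceExponent, ofReal_integral_eq_lintegral_ofReal _ hnn]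
    -- Integrability is essential: otherwise the Bochner integral would take its default value `0`.
    refine Integrable.mono' (hρ.integrable_min.const_mul (max 1 (n : ℝ))) (by fun_prop) ?_
    filter_upwards [hρ.ae_pos, hnn] with w hw hw'
    rw [Real.norm_of_nonneg hw', neg_mul]
    refine one_sub_exp_neg_le_min.trans ?_
    rw [mul_min_of_nonneg _ _ (by positivity)]
    refine min_le_min (by simp) ?_
    rw [mul_comm]
    gcongr
    exact le_max_right _ _
  simp only [h2, lintegral_one, htop] at h1
  rw [ENNReal.tendsto_ofReal_nhds_top] at h1
  exact h1

end IsLevyMeasure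

/-! ### Lower shares of random vectors -/

section Probability

variable {Ω : Type*} [MeasurableSpace Ω] {P : Measure Ω}

theorem memLp_two_of_hasLaw_gaussianReal {V : Ω → ℝ} {v : ℝ≥0}
    (hV : HasLaw V (gaussianReal 0 v) P) : MemLp V 2 P := by
  have h := memLp_id_gaussianReal (μ := 0) (v := v) 2
  rw [← hV.map_eq] at h
  exact (memLp_map_measure_iff h.1 hV.aemeasurable).1 h

theorem integral_sq_of_hasLaw_gaussianReal {V : Ω → ℝ} {v : ℝ≥0}
    (hV : HasLaw V (gaussianReal 0 v) P) : ∫ ω, V ω ^ 2 ∂P = v := by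
  rw [← variance_of_integral_eq_zero hV.aemeasurable
    (by rw [hV.integral_eq]; exact integral_id_gaussianReal), hV.variance_eq,
    variance_id_gaussianReal]

variable [IsProbabilityMeasure P]

theorem measureReal_le_of_ae {s t : Set Ω} (h : ∀ᵐ ω ∂P, ω ∈ s → ω ∈ t) :
    P.real s ≤ P.real t :=
  ENNReal.toReal_mono (measure_ne_top _ _) (measure_mono_ae h)

theorem integrable_exp_neg_mul {X : Ω → ℝ} (hm : AEMeasurable X P) (h0 : ∀ᵐ ω ∂P, 0 ≤ X ω)
    {t : ℝ} (ht : 0 ≤ t) : Integrable (fun ω => Real.exp (-t * X ω)) P := by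
  refine Integrable.of_bound (by fun_prop) 1 ?_
  filter_upwards [h0] with ω hω
  rw [Real.norm_of_nonneg (Real.exp_pos _).le, Real.exp_le_one_iff]
  nlinarith

/-- With `k = ⌊κ q⌋`, the bad event forces `G ≥ k / 2` or `G ≥ δ ε t / 2`, of total probability at
most `2 b(t) / k + 2 b(t) / (δ ε t)`. Only the bound on `E G` enters, not independence, so the
result also serves for the Gaussian mixtures. -/
theorem tendsto_measureReal_lowerShare {q : ℕ → ℕ} (hq : Tendsto q atTop atTop)
    {Y : (n : ℕ) → Fin (q n) → Ω → ℝ} (hm : ∀ n j, AEMeasurable (Y n j) P)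
    (h0 : ∀ n j, ∀ᵐ ω ∂P, 0 ≤ Y n j ω) {b : ℝ → ℝ}
    (hb : ∀ t, 0 < t → ∀ᶠ n in atTop, ∑ j, ∫ ω, (1 - Real.exp (-t * Y n j ω)) ∂P ≤ b t)
    (hb0 : Tendsto (fun t => b t / t) atTop (𝓝 0)) {κ : ℝ} (hκ : 0 < κ) {δ ε : ℝ} (hδ : 0 < δ)
    (hε : 0 < ε) :
    Tendsto (fun n => P.real {ω | δ ≤ ∑ j, Y n j ω ∧ ε ≤ lowerShare κ fun j => Y n j ω})
      atTop (𝓝 0) := by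
  rw [Metric.tendsto_atTop']
  intro η hη
  have hδε : 0 < δ * ε := mul_pos hδ hε
  -- `t` is fixed first, making the second term less than `η / 2`; the first is then made small by
  -- `k → ∞`.
  obtain ⟨t, ht, htb⟩ : ∃ t, 0 < t ∧ b t / t < δ * ε * η / 4 :=
    ((eventually_gt_atTop 0).and (hb0.eventually_lt_const (by positivity))).exists
  have hk : Tendsto (fun n => (⌊κ * q n⌋₊ : ℝ)) atTop atTop :=
    tendsto_natCast_atTop_atTop.comp (tendsto_nat_floor_atTop.comp
      ((tendsto_natCast_atTop_atTop.comp hq).const_mul_atTop hκ))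
  have hev := (hb t ht).and ((hk.eventually_gt_atTop (4 * b t / η)).and (hk.eventually_gt_atTop 0))
  obtain ⟨n₀, hn₀⟩ := eventually_atTop.1 hev
  refine ⟨n₀, fun n hn => ?_⟩
  obtain ⟨h1, h2, h3⟩ := hn₀ n hn.le
  set k : ℝ := (⌊κ * q n⌋₊ : ℝ)
  let G : Ω → ℝ := fun ω => ∑ j, (1 - Real.exp (-t * Y n j ω))
  have hint : ∀ j, Integrable (fun ω => 1 - Real.exp (-t * Y n j ω)) P := fun j =>
    (integrable_const _).sub (integrable_exp_neg_mul (hm n j) (h0 n j) ht.le)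
  have hGint : Integrable G P := integrable_finsetSum _ fun j _ => hint j
  have hY : ∀ᵐ ω ∂P, ∀ j, 0 ≤ Y n j ω := ae_all_iff.2 (h0 n)
  have hG0 : 0 ≤ᵐ[P] G := by
    filter_upwards [hY] with ω hω
    refine Finset.sum_nonneg fun j _ => sub_nonneg.2 (Real.exp_le_one_iff.2 ?_)
    nlinarith [hω j]
  have hGb : ∫ ω, G ω ∂P ≤ b t := by
    rw [integral_finsetSum _ fun j _ => hint j]
    exact h1
  have m1 := (mul_meas_ge_le_integral_of_nonneg hG0 hGint (k / 2)).trans hGb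
  have m2 := (mul_meas_ge_le_integral_of_nonneg hG0 hGint (δ * ε * t / 2)).trans hGb
  have hsub : P.real {ω | δ ≤ ∑ j, Y n j ω ∧ ε ≤ lowerShare κ fun j => Y n j ω} ≤
      P.real ({ω | k / 2 ≤ G ω} ∪ {ω | δ * ε * t / 2 ≤ G ω}) := by
    refine measureReal_le_of_ae ?_
    filter_upwards [hY] with ω hω hbad
    by_contra hnot
    simp only [Set.mem_union, Set.mem_ofPred_eq, not_or, not_le] at hnot hbad
    have := lowerShare_mul_sum_le (κ := κ) hω (inv_pos.2 ht) (by
      rw [inv_inv]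
      change 2 * G ω < k
      linarith [hnot.1])
    rw [inv_inv] at this
    change _ ≤ 2 * t⁻¹ * G ω at this
    have h4 : δ * ε ≤ 2 * t⁻¹ * G ω := by
      refine le_trans ?_ this
      rw [mul_comm]
      exact mul_le_mul hbad.2 hbad.1 hδ.le (hε.le.trans hbad.2)
    have h5 : 2 * t⁻¹ * G ω < 2 * t⁻¹ * (δ * ε * t / 2) :=
      mul_lt_mul_of_pos_left hnot.2 (by positivity)
    have h6 : 2 * t⁻¹ * (δ * ε * t / 2) = δ * ε := by field_simp
    linarith
  have p1 : P.real {ω | k / 2 ≤ G ω} < η / 2 := by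
    rw [div_lt_iff₀ hη] at h2
    by_contra! hle
    nlinarith
  have p2 : P.real {ω | δ * ε * t / 2 ≤ G ω} < η / 2 := by
    rw [div_lt_iff₀ ht] at htb
    have : 0 < δ * ε * t / 2 := by positivity
    by_contra! hle
    nlinarith
  rw [Real.dist_0_eq_abs, abs_of_nonneg measureReal_nonneg]
  linarith [measureReal_union_le (μ := P) {ω | k / 2 ≤ G ω} {ω | δ * ε * t / 2 ≤ G ω}]

/-- Independence factorises the Laplace transform of the sum; then `1 - x ≤ -log x` is applied to
each factor. -/
theorem sum_integral_one_sub_exp_le_neg_log {q : ℕ} {X : Fin q → Ω → ℝ}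
    (hm : ∀ j, AEMeasurable (X j) P) (h0 : ∀ j, ∀ᵐ ω ∂P, 0 ≤ X j ω) (hind : iIndepFun X P)
    {t : ℝ} (ht : 0 ≤ t) :
    ∑ j, ∫ ω, (1 - Real.exp (-t * X j ω)) ∂P ≤
      -Real.log (∫ ω, Real.exp (-t * ∑ j, X j ω) ∂P) := by
  have h1 := hind.mgf_sum₀ (t := -t) hm Finset.univ
  have h2 : ∫ ω, Real.exp (-t * ∑ j, X j ω) ∂P = ∏ j, mgf (X j) P (-t) := by
    rw [← h1]
    simp [mgf]
  have hint := fun j => integrable_exp_neg_mul (hm j) (h0 j) ht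
  have hpos : ∀ j, 0 < mgf (X j) P (-t) := fun j => mgf_pos (hint j)
  rw [h2, Real.log_prod fun j _ => (hpos j).ne', ← Finset.sum_neg_distrib]
  refine Finset.sum_le_sum fun j _ => ?_
  rw [integral_sub (integrable_const _) (hint j)]
  have := Real.log_le_sub_one_of_pos (hpos j)
  simp only [integral_const, probReal_univ, smul_eq_mul, mul_one]
  change 1 - mgf (X j) P (-t) ≤ _
  linarith

theorem tendsto_laplace_of_tendstoInDistribution {Ω' : Type*} [MeasurableSpace Ω']
    {P' : Measure Ω'} [IsProbabilityMeasure P'] {S : ℕ → Ω → ℝ} {Λ : Ω' → ℝ}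
    (hconv : TendstoInDistribution S atTop Λ (fun _ => P) P') (hS : ∀ n, ∀ᵐ ω ∂P, 0 ≤ S n ω)
    {a : ℝ} {ρ : Measure ℝ} (hΛ : IsID a ρ (P'.map Λ)) {t : ℝ} (ht : 0 ≤ t) :
    Tendsto (fun n => ∫ ω, Real.exp (-t * S n ω) ∂P) atTop
      (𝓝 (Real.exp (-t * a - laplaceExponent ρ t))) := by
  -- Truncation at `0` makes the exponential bounded on the line and changes nothing almost surely.
  let f : BoundedContinuousFunction ℝ ℝ :=
    BoundedContinuousFunction.ofNormedAddCommGroup (fun x => Real.exp (-t * max x 0))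
      (by fun_prop) 1 fun x => by
        rw [Real.norm_of_nonneg (Real.exp_pos _).le, Real.exp_le_one_iff]
        nlinarith [le_max_right x 0]
  have h := ProbabilityMeasure.tendsto_iff_forall_integral_tendsto.1 hconv.tendsto f
  have hlim : ∫ x, f x ∂(P'.map Λ) = Real.exp (-t * a - laplaceExponent ρ t) := by
    rw [laplaceExponent, ← hΛ.laplace t ht]
    refine integral_congr_ae ?_
    have : ∀ᵐ x ∂(P'.map Λ), 0 ≤ x := by
      rw [ae_iff]
      simpa [Set.Iio] using hΛ.carrier
    filter_upwards [this] with x hx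
    simp [f, hx]
  have hn : ∀ n, ∫ x, f x ∂(P.map (S n)) = ∫ ω, Real.exp (-t * S n ω) ∂P := fun n => by
    rw [integral_map (hconv.forall_aemeasurable n) f.continuous.aestronglyMeasurable]
    refine integral_congr_ae ?_
    filter_upwards [hS n] with ω hω
    simp [f, hω]
  simpa [hn, hlim] using h

/-! ### Gaussian factors -/

/-- Continuity from above, as a nondegenerate Gaussian has no atom at `0`. -/
theorem exists_gaussianReal_sq_lt_le {v : ℝ≥0} (hv : v ≠ 0) {θ : ℝ} (hθ : 0 < θ) :
    ∃ s, 0 < s ∧ (gaussianReal 0 v).real {x | x ^ 2 < s} ≤ θ := by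
  have := nullSingletonClass_gaussianReal (μ := 0) hv
  have h : Tendsto (fun m : ℕ => gaussianReal 0 v {x | x ^ 2 < 1 / ((m : ℝ) + 1)}) atTop
      (𝓝 (gaussianReal 0 v (⋂ m : ℕ, {x | x ^ 2 < 1 / ((m : ℝ) + 1)}))) := by
    refine tendsto_measure_iInter_atTop (fun m => ?_) ?_ ⟨0, measure_ne_top _ _⟩
    · exact (measurableSet_lt (by fun_prop) (by fun_prop)).nullMeasurableSet
    · intro m k hmk x hx
      have hx' : x ^ 2 < 1 / ((k : ℝ) + 1) := hx
      exact hx'.trans_le (Nat.one_div_le_one_div hmk)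
  have hI : (⋂ m : ℕ, {x : ℝ | x ^ 2 < 1 / ((m : ℝ) + 1)}) ⊆ {0} := by
    intro x hx
    simp only [Set.mem_iInter, Set.mem_ofPred_eq] at hx
    by_contra hne
    obtain ⟨m, hm⟩ := exists_nat_one_div_lt (pow_pos (abs_pos.2 hne) 2)
    rw [sq_abs] at hm
    exact lt_asymm hm (hx m)
  rw [measure_mono_null hI (measure_singleton 0)] at h
  obtain ⟨m, hm⟩ := (h.eventually_lt_const (ENNReal.ofReal_pos.2 hθ)).exists
  refine ⟨_, Nat.one_div_pos_of_nat, ENNReal.toReal_le_of_le_ofReal hθ.le hm.le⟩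

/-- Jensen's inequality conditionally on `X`: the factor `(v m)⁻¹ ∑ₖ Vₖ²` has mean one and `y ↦ 1 -
exp (-t y)` is concave. Using the tangent line at `X` avoids conditional expectations; the linear
term integrates to zero by independence. -/
theorem integral_one_sub_exp_gaussian_mixture_le {m : ℕ} (hm : 1 ≤ m) {v : ℝ≥0} (hv : v ≠ 0)
    {X : Ω → ℝ} {V : Fin m → Ω → ℝ} (hX : AEMeasurable X P) (h0 : ∀ᵐ ω ∂P, 0 ≤ X ω)
    (hV : ∀ k, HasLaw (V k) (gaussianReal 0 v) P) (hind : ∀ k, IndepFun X (V k) P)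
    {t : ℝ} (ht : 0 ≤ t) :
    ∫ ω, (1 - Real.exp (-t * ((v * m : ℝ)⁻¹ * ∑ k, (√(X ω) * V k ω) ^ 2))) ∂P ≤
      ∫ ω, (1 - Real.exp (-t * X ω)) ∂P := by
  have hVm := fun k => (hV k).aemeasurable
  have hv0 : (0 : ℝ) < v := by positivity
  have hm0 : (0 : ℝ) < m := by positivity
  -- The tangent slope times `x`; it is bounded because `y ≤ exp y`, so `X` itself need not be
  -- integrable.
  let g : ℝ → ℝ := fun x => Real.exp (-t * x) * (t * x)
  have hg : Measurable g := by fun_prop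
  have hgint : Integrable (fun ω => g (X ω)) P := by
    refine Integrable.of_bound (by fun_prop) 1 ?_
    filter_upwards [h0] with ω hω
    have hy : 0 ≤ t * X ω := mul_nonneg ht hω
    rw [Real.norm_of_nonneg (mul_nonneg (Real.exp_pos _).le hy), neg_mul, Real.exp_neg,
      inv_mul_le_one₀ (Real.exp_pos _)]
    linarith [Real.add_one_le_exp (t * X ω)]
  have hsq : ∀ k, Integrable (fun ω => V k ω ^ 2 - v) P := fun k =>
    (memLp_two_of_hasLaw_gaussianReal (hV k)).integrable_sq.sub (integrable_const _)
  have hI : ∀ k, IndepFun (fun ω => g (X ω)) (fun ω => V k ω ^ 2 - v) P := fun k =>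
    (hind k).comp (φ := g) (ψ := fun x : ℝ => x ^ 2 - (v : ℝ)) hg (by fun_prop)
  have hprod : ∀ k, Integrable (fun ω => g (X ω) * (V k ω ^ 2 - v)) P := fun k =>
    (hI k).integrable_mul hgint (hsq k)
  have hzero : ∀ k, ∫ ω, g (X ω) * (V k ω ^ 2 - v) ∂P = 0 := fun k => by
    rw [(hI k).integral_fun_mul_eq_mul_integral hgint.1 (hsq k).1,
      integral_sub (memLp_two_of_hasLaw_gaussianReal (hV k)).integrable_sq (integrable_const _),
      integral_sq_of_hasLaw_gaussianReal (hV k)]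
    simp
  have hE := integrable_exp_neg_mul hX h0 ht
  have hR : Integrable (fun ω => ∑ k, g (X ω) * (V k ω ^ 2 - v)) P :=
    integrable_finsetSum _ fun k _ => hprod k
  calc
    _ ≤ ∫ ω, ((1 - Real.exp (-t * X ω)) +
          (v * m : ℝ)⁻¹ * ∑ k, g (X ω) * (V k ω ^ 2 - v)) ∂P := by
      refine integral_mono_ae ?_ (((integrable_const _).sub hE).add (hR.const_mul _)) ?_
      · refine (integrable_const _).sub (integrable_exp_neg_mul (by fun_prop) ?_ ht)
        exact .of_forall fun ω => by positivity
      · filter_upwards [h0] with ω hω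
        have h1 : ∑ k, (√(X ω) * V k ω) ^ 2 = X ω * ∑ k, V k ω ^ 2 := by
          rw [Finset.mul_sum]
          simp_rw [mul_pow, Real.sq_sqrt hω]
        have h2 : ∑ k, g (X ω) * (V k ω ^ 2 - v) = g (X ω) * (∑ k, V k ω ^ 2 - v * m) := by
          rw [← Finset.mul_sum, Finset.sum_sub_distrib]
          simp [mul_comm]
        rw [h1, h2]
        set C := ∑ k, V k ω ^ 2
        have h3 : -t * ((v * m : ℝ)⁻¹ * (X ω * C)) =
            -t * X ω + -(t * X ω * ((v * m : ℝ)⁻¹ * (C - v * m))) := by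
          field_simp
          ring
        have h4 := Real.add_one_le_exp (-(t * X ω * ((v * m : ℝ)⁻¹ * (C - v * m))))
        have h5 := mul_le_mul_of_nonneg_left h4 (Real.exp_pos (-t * X ω)).le
        rw [h3, Real.exp_add]
        simp only [g]
        linarith
    _ = _ := by
      have h1E : Integrable (fun ω => 1 - Real.exp (-t * X ω)) P := (integrable_const _).sub hE
      rw [integral_add h1E (hR.const_mul _), integral_const_mul,
        integral_finsetSum _ fun k _ => hprod k]
      simp [hzero]

/-- Weight each pair `(j, k)` by the share of `X j` in the total. The expected weight `F` of the
pairs with `V² < s` is at most `m τ`, so `F < m / 2` except with probability `2 τ`. The remaining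
pairs then carry at least half of the total, each with `V² ≥ s`. -/
theorem measureReal_gaussian_mixture_total_lt_le {q m : ℕ} (hm : 1 ≤ m) {v : ℝ≥0} (hv : v ≠ 0)
    {X : Fin q → Ω → ℝ} {V : Fin q → Fin m → Ω → ℝ} (hX : ∀ j, AEMeasurable (X j) P)
    (h0 : ∀ j, ∀ᵐ ω ∂P, 0 ≤ X j ω) (hV : ∀ j k, HasLaw (V j k) (gaussianReal 0 v) P)
    (hind : ∀ j k, IndepFun (fun ω i => X i ω) (V j k) P) {s δ : ℝ} (hs : 0 < s) (hδ : 0 < δ) :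
    P.real {ω | δ ≤ ∑ j, X j ω ∧
        ∑ j, (v * m : ℝ)⁻¹ * ∑ k, (√(X j ω) * V j k ω) ^ 2 < s * δ / (2 * v)} ≤
      2 * (gaussianReal 0 v).real {x | x ^ 2 < s} := by
  have hv0 : (0 : ℝ) < v := by positivity
  have hm0 : (0 : ℝ) < m := by positivity
  have hVm := fun j k => (hV j k).aemeasurable
  set τ := (gaussianReal 0 v).real {x | x ^ 2 < s}
  have hmeas : MeasurableSet {x : ℝ | x ^ 2 < s} := measurableSet_lt (by fun_prop) (by fun_prop)
  let ψ : ℝ → ℝ := Set.indicator {x | x ^ 2 < s} 1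
  have hψ : Measurable ψ := measurable_one.indicator hmeas
  have hψ01 : ∀ x, 0 ≤ ψ x ∧ ψ x ≤ 1 := fun x => by
    by_cases h : x ^ 2 < s <;> simp [ψ, h]
  let φ : Fin q → (Fin q → ℝ) → ℝ := fun j x => x j / ∑ i, x i
  have hφ : ∀ j, Measurable (φ j) := fun j => by fun_prop
  have hX0 : ∀ᵐ ω ∂P, ∀ j, 0 ≤ X j ω := ae_all_iff.2 h0
  have hφint : ∀ j, Integrable (fun ω => φ j fun i => X i ω) P := fun j => by
    refine Integrable.of_bound
      ((hφ j).comp_aemeasurable (aemeasurable_pi_lambda _ hX)).aestronglyMeasurable 1 ?_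
    filter_upwards [hX0] with ω hω
    have hsum := Finset.sum_nonneg fun j (_ : j ∈ Finset.univ) => hω j
    rw [Real.norm_of_nonneg (div_nonneg (hω j) hsum)]
    exact div_le_one_of_le₀ (Finset.single_le_sum (f := fun i => X i ω) (fun i _ => hω i)
      (Finset.mem_univ j)) hsum
  have hψint : ∀ j k, Integrable (fun ω => ψ (V j k ω)) P := fun j k =>
    Integrable.of_bound (hψ.comp_aemeasurable (hVm j k)).aestronglyMeasurable 1 (.of_forall fun ω => by
      rw [Real.norm_of_nonneg (hψ01 _).1]
      exact (hψ01 _).2)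
  have hψE : ∀ j k, ∫ ω, ψ (V j k ω) ∂P = τ := fun j k => by
    have := (hV j k).integral_comp (f := ψ) hψ.aestronglyMeasurable
    simp only [Function.comp_def] at this
    rw [this, integral_indicator_one hmeas]
  have hI : ∀ j k, IndepFun (fun ω => φ j fun i => X i ω) (fun ω => ψ (V j k ω)) P := fun j k =>
    (hind j k).comp (hφ j) hψ
  have hprod : ∀ j k, Integrable (fun ω => (φ j fun i => X i ω) * ψ (V j k ω)) P := fun j k =>
    (hI j k).integrable_mul (hφint j) (hψint j k)
  let F : Ω → ℝ := fun ω => ∑ j, ∑ k, (φ j fun i => X i ω) * ψ (V j k ω)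
  have hFint : Integrable F P :=
    integrable_finsetSum _ fun j _ => integrable_finsetSum _ fun k _ => hprod j k
  have hF0 : 0 ≤ᵐ[P] F := by
    filter_upwards [hX0] with ω hω
    exact Finset.sum_nonneg fun j _ => Finset.sum_nonneg fun k _ =>
      mul_nonneg (div_nonneg (hω j) (Finset.sum_nonneg fun i _ => hω i)) (hψ01 _).1
  have hFE : ∫ ω, F ω ∂P ≤ m * τ := by
    calc
      ∫ ω, F ω ∂P = ∑ j, ∑ _k : Fin m, (∫ ω, φ j fun i => X i ω ∂P) * τ := by
        rw [integral_finsetSum _ fun j _ => integrable_finsetSum _ fun k _ => hprod j k]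
        refine Finset.sum_congr rfl fun j _ => ?_
        rw [integral_finsetSum _ fun k _ => hprod j k]
        refine Finset.sum_congr rfl fun k _ => ?_
        rw [(hI j k).integral_fun_mul_eq_mul_integral (hφint j).1 (hψint j k).1, hψE]
      _ = m * τ * ∫ ω, ∑ j, (φ j fun i => X i ω) ∂P := by
        rw [integral_finsetSum _ fun j _ => hφint j, Finset.mul_sum]
        refine Finset.sum_congr rfl fun j _ => ?_
        simp
        ring
      _ ≤ m * τ * ∫ _, (1 : ℝ) ∂P := by
        refine mul_le_mul_of_nonneg_left (integral_mono (integrable_finsetSum _ fun j _ => hφint j)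
          (integrable_const _) fun ω => ?_) (mul_nonneg hm0.le measureReal_nonneg)
        simp only [φ]
        rw [← Finset.sum_div]
        -- The shares sum to one, or to `0` when the total vanishes.
        exact div_self_le_one _
      _ = m * τ := by simp
  have hM := (mul_meas_ge_le_integral_of_nonneg hF0 hFint (m / 2)).trans hFE
  have hM' : P.real {ω | m / 2 ≤ F ω} ≤ 2 * τ := by
    by_contra! h
    nlinarith
  refine le_trans (measureReal_le_of_ae ?_) hM'
  filter_upwards [hX0] with ω hω ⟨h1, h2⟩
  by_contra hlt
  simp only [not_le] at hlt
  set S := ∑ j, X j ω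
  have hS : 0 < S := hδ.trans_le h1
  have hSF : ∑ j, ∑ k, X j ω * ψ (V j k ω) = S * F ω := by
    simp only [F, φ, Finset.mul_sum]
    refine Finset.sum_congr rfl fun j _ => Finset.sum_congr rfl fun k _ => ?_
    change _ = S * (X j ω / S * _)
    field_simp
  -- Terms with `V² < s` are dropped; in the others `V²` is replaced by `s`.
  have hlow : s * (m * S - S * F ω) ≤ ∑ j, ∑ k, (√(X j ω) * V j k ω) ^ 2 := by
    calc
      s * (m * S - S * F ω) = ∑ j, ∑ k, s * (X j ω * (1 - ψ (V j k ω))) := by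
        have hSm : ∑ j, ∑ _k : Fin m, X j ω = m * S := by simp [S, Finset.mul_sum]
        rw [← hSF, ← hSm]
        simp only [← Finset.sum_sub_distrib, Finset.mul_sum, mul_sub, mul_one]
      _ ≤ _ := by
        refine Finset.sum_le_sum fun j _ => Finset.sum_le_sum fun k _ => ?_
        rw [mul_pow, Real.sq_sqrt (hω j)]
        by_cases h : V j k ω ^ 2 < s
        · simp only [ψ, Set.indicator, Set.mem_ofPred_eq, h, if_true, Pi.one_apply, sub_self,
            mul_zero]
          exact mul_nonneg (hω j) (sq_nonneg _)
        · simp only [ψ, Set.indicator, Set.mem_ofPred_eq, h, if_false, sub_zero, mul_one]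
          nlinarith [hω j]
  rw [← Finset.mul_sum] at h2
  have h3 : s * (m * δ / 2) ≤ s * (m * S - S * F ω) := by
    refine mul_le_mul_of_nonneg_left ?_ hs.le
    nlinarith
  have h4 : (v * m : ℝ)⁻¹ * (s * (m * δ / 2)) = s * δ / (2 * v) := by field_simp
  have h5 := mul_le_mul_of_nonneg_left (h3.trans hlow) (inv_nonneg.2 (mul_pos hv0 hm0).le)
  linarith

end Probability

/-! ### Random networks -/

namespace MixtureNetwork.HasDistribution

variable {Ω : Type*} [MeasurableSpace Ω] {P : Measure Ω} {p : ℕ → ℕ} {N : MixtureNetwork p Ω}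
  {L : ℕ} {μ : ℕ → Measure ℝ} {σv σb : ℝ≥0} {l : ℕ}

theorem aemeasurable_param (h : N.HasDistribution L μ σv σb P) (i : ParamIndex L p) :
    AEMeasurable (N.param L i) P := by
  cases i with
  | nodeVar l h₁ h₂ j => exact (h.nodeVar_law l h₁ h₂ j).aemeasurable
  | gauss l hl j k => exact (h.gauss_law l hl j k).aemeasurable
  | bias l hl k => exact (h.bias_law l hl k).aemeasurable

theorem ae_nodeVar_nonneg (h : N.HasDistribution L μ σv σb P) (h₁ : 1 ≤ l) (hL : l ≤ L)
    (j : Fin (p l)) : ∀ᵐ ω ∂P, 0 ≤ N.nodeVar l j ω := by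
  rw [(h.nodeVar_law l h₁ hL j).ae_iff (p := fun x => 0 ≤ x) (by fun_prop), ae_iff]
  simpa [Set.Iio] using h.nodeVar_carrier l h₁ hL

theorem iIndepFun_nodeVar (h : N.HasDistribution L μ σv σb P) (h₁ : 1 ≤ l) (hL : l ≤ L) :
    iIndepFun (N.nodeVar l) P :=
  h.indep.precomp (g := ParamIndex.nodeVar l h₁ hL) fun i j hij => by simpa using hij

/-- The whole vector of node variances is needed, since the shares `X j / S` involve every node of
the layer. The two blocks of labels are disjoint. -/
theorem indepFun_nodeVar_gauss (h : N.HasDistribution L μ σv σb P) (h₁ : 1 ≤ l) (hL : l ≤ L)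
    (j : Fin (p l)) (k : Fin (p (l + 1))) :
    IndepFun (fun ω i => N.nodeVar l i ω) (N.gauss l j k) P := by
  classical
  let A : Finset (ParamIndex L p) := Finset.univ.image (ParamIndex.nodeVar l h₁ hL)
  let B : Finset (ParamIndex L p) := {ParamIndex.gauss l hL j k}
  have hAB : Disjoint A B := by simp [A, B]
  have hA : ∀ i, ParamIndex.nodeVar l h₁ hL i ∈ A := by simp [A]
  have hB : ParamIndex.gauss l hL j k ∈ B := by simp [B]
  have hind := h.indep.indepFun_finset₀ A B hAB h.aemeasurable_param
  have hψ : Measurable fun x : B → ℝ => x ⟨_, hB⟩ := measurable_pi_apply (X := fun _ => ℝ) _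
  exact hind.comp (φ := fun x i => x ⟨_, hA i⟩)
    (measurable_pi_lambda _ fun i => measurable_pi_apply _) hψ

end MixtureNetwork.HasDistribution

/-! ### Convergence in probability and shares of Gaussian mixtures -/

section Convergence

variable {Ω : Type*} [MeasurableSpace Ω] {P : Measure Ω}

theorem tendstoInMeasure_zero_of_restricted {S Z : ℕ → Ω → ℝ}
    (hZ : ∀ n, ∀ᵐ ω ∂P, 0 ≤ Z n ω) (hSZ : ∀ n, ∀ᵐ ω ∂P, 0 < S n ω ∨ Z n ω = 0)
    (hsmall : ∀ η : ℝ≥0∞, 0 < η → ∃ δ, 0 < δ ∧ ∀ᶠ n in atTop, P {ω | 0 < S n ω ∧ S n ω ≤ δ} ≤ η)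
    (h : ∀ δ > 0, ∀ ε > 0, Tendsto (fun n => P {ω | δ ≤ S n ω ∧ ε ≤ Z n ω}) atTop (𝓝 0)) :
    TendstoInMeasure P Z atTop fun _ => 0 := by
  rw [tendstoInMeasure_iff_norm]
  intro ε hε
  rw [ENNReal.tendsto_nhds_zero]
  intro η hη
  have hη2 : 0 < η / 2 := ENNReal.half_pos hη.ne'
  obtain ⟨δ, hδ, hev⟩ := hsmall _ hη2
  filter_upwards [hev, (ENNReal.tendsto_nhds_zero.1 (h δ hδ ε hε)) _ hη2] with n h1 h2
  calc
    _ ≤ P ({ω | 0 < S n ω ∧ S n ω ≤ δ} ∪ {ω | δ ≤ S n ω ∧ ε ≤ Z n ω}) := by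
      refine measure_mono_ae ?_
      filter_upwards [hZ n, hSZ n] with ω hω hω'
      intro hmem
      change ε ≤ ‖Z n ω - 0‖ at hmem
      rw [sub_zero, Real.norm_of_nonneg hω] at hmem
      rcases hω' with hpos | hzero
      · rcases le_total (S n ω) δ with hle | hle
        · exact .inl ⟨hpos, hle⟩
        · exact .inr ⟨hle, hmem⟩
      · linarith
    _ ≤ η / 2 + η / 2 := (measure_union_le _ _).trans (add_le_add h1 h2)
    _ = η := ENNReal.add_halves η

variable [IsProbabilityMeasure P]

/-- Markov's inequality for `exp (-m S)` gives `P(S ≤ 1/m) ≤ e E exp (-m S)`, whose limit `e exp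
(-ψ(m))` is small for large `m` when `ρ` is infinite. -/
theorem eventually_measure_le_le_of_laplace {Ω' : Type*} [MeasurableSpace Ω']
    {P' : Measure Ω'} [IsProbabilityMeasure P'] {S : ℕ → Ω → ℝ} {Λ : Ω' → ℝ}
    (hconv : TendstoInDistribution S atTop Λ (fun _ => P) P') (hS : ∀ n, ∀ᵐ ω ∂P, 0 ≤ S n ω)
    {ρ : Measure ℝ} (hΛ : IsID 0 ρ (P'.map Λ)) (hρ : ρ Set.univ = ∞) {η : ℝ} (hη : 0 < η) :
    ∃ δ, 0 < δ ∧ ∀ᶠ n in atTop, P.real {ω | S n ω ≤ δ} < η := by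
  have h1 : Tendsto (fun m : ℕ => Real.exp (-laplaceExponent ρ m)) atTop (𝓝 0) :=
    Real.tendsto_exp_neg_atTop_nhds_zero.comp (hΛ.levy.tendsto_laplaceExponent_atTop hρ)
  have hc : 0 < Real.exp (-1) * η := mul_pos (Real.exp_pos _) hη
  obtain ⟨m, hm, hm1⟩ := ((h1.eventually_lt_const hc).and (eventually_ge_atTop 1)).exists
  have hm0 : (0 : ℝ) < m := by positivity
  have h2 := tendsto_laplace_of_tendstoInDistribution hconv hS hΛ hm0.le
  rw [mul_zero, zero_sub] at h2
  refine ⟨(m : ℝ)⁻¹, inv_pos.2 hm0, ?_⟩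
  filter_upwards [h2.eventually_lt_const hm] with n hn
  have h3 := mul_meas_ge_le_integral_of_nonneg (.of_forall fun ω => (Real.exp_pos _).le)
    (integrable_exp_neg_mul (hconv.forall_aemeasurable n) (hS n) hm0.le) (Real.exp (-1))
  have h4 : {ω | S n ω ≤ (m : ℝ)⁻¹} = {ω | Real.exp (-1) ≤ Real.exp (-m * S n ω)} := by
    ext ω
    change S n ω ≤ (m : ℝ)⁻¹ ↔ Real.exp (-1) ≤ Real.exp (-m * S n ω)
    rw [Real.exp_le_exp, neg_mul, neg_le_neg_iff, ← le_div_iff₀' hm0, one_div]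
  rw [h4]
  exact lt_of_mul_lt_mul_left (h3.trans_lt hn) (Real.exp_pos _).le

theorem tendsto_measure_zero_of_measureReal {s : ℕ → Set Ω}
    (h : Tendsto (fun n => P.real (s n)) atTop (𝓝 0)) :
    Tendsto (fun n => P (s n)) atTop (𝓝 0) := by
  simpa using ENNReal.tendsto_ofReal h

/-- The lower shares of a Gaussian variance mixture vanish wherever the total of the mixing
variables does not. -/
theorem tendsto_measureReal_lowerShare_gaussian_mixture {q m : ℕ → ℕ}
    (hq : Tendsto q atTop atTop) (hm : ∀ n, 1 ≤ m n) {v : ℝ≥0} (hv : v ≠ 0)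
    {X : (n : ℕ) → Fin (q n) → Ω → ℝ} {V : (n : ℕ) → Fin (q n) → Fin (m n) → Ω → ℝ}
    (hX : ∀ n j, AEMeasurable (X n j) P) (h0 : ∀ n j, ∀ᵐ ω ∂P, 0 ≤ X n j ω)
    (hV : ∀ n j k, HasLaw (V n j k) (gaussianReal 0 v) P)
    (hind : ∀ n j k, IndepFun (fun ω i => X n i ω) (V n j k) P) {b : ℝ → ℝ}
    (hb : ∀ t, 0 < t → ∀ᶠ n in atTop, ∑ j, ∫ ω, (1 - Real.exp (-t * X n j ω)) ∂P ≤ b t)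
    (hb0 : Tendsto (fun t => b t / t) atTop (𝓝 0)) {κ : ℝ} (hκ : 0 < κ) {δ ε : ℝ} (hδ : 0 < δ)
    (hε : 0 < ε) :
    Tendsto (fun n => P.real {ω | δ ≤ ∑ j, X n j ω ∧
      ε ≤ lowerShare κ fun j => ∑ k, (√(X n j ω) * V n j k ω) ^ 2}) atTop (𝓝 0) := by
  have hv0 : (0 : ℝ) < v := by positivity
  have hm0 : ∀ n, (0 : ℝ) < m n := fun n => Nat.cast_pos.2 (hm n)
  have hVm := fun n j k => (hV n j k).aemeasurable
  have hindj : ∀ n j k, IndepFun (X n j) (V n j k) P := fun n j k =>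
    (hind n j k).comp (φ := fun x : Fin (q n) → ℝ => x j) (measurable_pi_apply j) measurable_id
  have hcore := fun δ' (hδ' : 0 < δ') => tendsto_measureReal_lowerShare (P := P) hq
    (Y := fun n j ω => (v * m n : ℝ)⁻¹ * ∑ k, (√(X n j ω) * V n j k ω) ^ 2)
    (fun n j => by fun_prop) (fun n j => .of_forall fun ω => by positivity) (b := b)
    (fun t ht => by
      filter_upwards [hb t ht] with n hn
      refine (Finset.sum_le_sum fun j _ => ?_).trans hn
      exact integral_one_sub_exp_gaussian_mixture_le (hm n) hv (hX n j) (h0 n j) (hV n j)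
        (hindj n j) ht.le) hb0 hκ hδ' hε
  rw [Metric.tendsto_nhds]
  intro η hη
  -- The event of a small normalised total has probability at most twice this bound, that is `η /
  -- 2`.
  obtain ⟨s, hs, hsτ⟩ := exists_gaussianReal_sq_lt_le hv (θ := η / 4) (by positivity)
  have hδ' : 0 < s * δ / (2 * v) := by positivity
  filter_upwards [(hcore _ hδ').eventually_lt_const (half_pos hη)] with n hn
  rw [Real.dist_0_eq_abs, abs_of_nonneg measureReal_nonneg]
  have h1 := measureReal_gaussian_mixture_total_lt_le (hm n) hv (hX n) (h0 n) (hV n) (hind n) hs hδ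
  refine ((measureReal_mono ?_).trans (measureReal_union_le _ _)).trans_lt
    ((add_lt_add_of_le_of_lt h1 hn).trans_le (by linarith))
  rintro ω ⟨hω1, hω2⟩
  rcases lt_or_ge (∑ j, (v * m n : ℝ)⁻¹ * ∑ k, (√(X n j ω) * V n j k ω) ^ 2)
    (s * δ / (2 * v)) with h | h
  · exact .inl ⟨hω1, h⟩
  · refine .inr ⟨h, ?_⟩
    rwa [lowerShare_const_mul κ (inv_pos.2 (mul_pos hv0 (hm0 n)))]

end Convergence

end

/-! ### Compressibility of a network layer -/

theorem mainTheorem5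
    {Ω Ω' : Type*} [MeasurableSpace Ω] [MeasurableSpace Ω']
    (P : Measure Ω) [IsProbabilityMeasure P] (P' : Measure Ω') [IsProbabilityMeasure P']
    -- a sequence of networks with `L` hidden layers; `p n l` is the width of layer `l` of the
    -- `n`-th one, `μ l q` the law of the node variances of layer `l` when it has `q` nodes
    (L : ℕ) (p : ℕ → ℕ → ℕ) (N : (n : ℕ) → MixtureNetwork (p n) Ω)
    (μ : ℕ → ℕ → Measure ℝ) (σv σb : ℝ≥0) (hσv : 0 < σv)
    (hN : ∀ n, (N n).HasDistribution L (fun l => μ l (p n l)) σv σb P)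
    -- the layer under consideration
    (l : ℕ) (hl₁ : 1 ≤ l) (hlL : l ≤ L)
    (hp : Tendsto (fun n => p n l) atTop atTop)
    (a : ℝ) (ρ : Measure ℝ) (Λ : Ω' → ℝ) (hΛ : IsID a ρ (P'.map Λ))
    (hconv : TendstoInDistribution (fun n => (N n).totalVar l) atTop Λ (fun _ => P) P')
    (ha : a = 0) :
    -- for every Lévy measure: the shares vanish in probability where the total does not vanish
    (∀ κ ∈ Set.Ioo (0 : ℝ) 1, ∀ δ > 0, ∀ ε > 0,
      Tendsto (fun n => P {ω | δ ≤ (N n).totalVar l ω ∧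
        ε ≤ lowerShare κ fun j => (N n).nodeVar l j ω}) atTop (𝓝 0) ∧
      Tendsto (fun n => P {ω | δ ≤ (N n).totalVar l ω ∧
        ε ≤ lowerShare κ fun j => (N n).outNormSq l j ω}) atTop (𝓝 0)) ∧
    -- unrestricted convergence, if `Λ > 0` almost surely (an infinite Lévy measure) or, more
    -- generally, if a nonzero total is not asymptotically negligible
    ((ρ Set.univ = ∞ ∨
        Tendsto (fun δ : ℝ => limsup (fun n => P {ω | 0 < (N n).totalVar l ω ∧
          (N n).totalVar l ω ≤ δ}) atTop) (𝓝[>] 0) (𝓝 0)) →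
      (∀ κ ∈ Set.Ioo (0 : ℝ) 1,
        TendstoInMeasure P (fun n ω => lowerShare κ fun j => (N n).nodeVar l j ω)
          atTop fun _ => 0) ∧
      IsNormCompressible P N l) := by
  subst ha
  have hm : ∀ n j, AEMeasurable ((N n).nodeVar l j) P := fun n j =>
    ((hN n).nodeVar_law l hl₁ hlL j).aemeasurable
  have h0 : ∀ n j, ∀ᵐ ω ∂P, 0 ≤ (N n).nodeVar l j ω := fun n =>
    (hN n).ae_nodeVar_nonneg hl₁ hlL
  have h0' : ∀ n, ∀ᵐ ω ∂P, ∀ j, 0 ≤ (N n).nodeVar l j ω := fun n => ae_all_iff.2 (h0 n)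
  have hS : ∀ n, ∀ᵐ ω ∂P, 0 ≤ (N n).totalVar l ω := fun n => by
    filter_upwards [h0' n] with ω hω
    exact Finset.sum_nonneg fun j _ => hω j
  -- The slack `1` turns the limit into an eventual bound and is harmless after division by `t`.
  have hb : ∀ t, 0 < t → ∀ᶠ n in atTop,
      ∑ j, ∫ ω, (1 - Real.exp (-t * (N n).nodeVar l j ω)) ∂P ≤ laplaceExponent ρ t + 1 := by
    intro t ht
    have h1 := tendsto_laplace_of_tendstoInDistribution hconv hS hΛ ht.le
    rw [mul_zero, zero_sub] at h1
    have h2 := (h1.log (Real.exp_pos _).ne').neg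
    rw [Real.log_exp, neg_neg] at h2
    filter_upwards [h2.eventually_le_const (lt_add_one _)] with n hn
    exact (sum_integral_one_sub_exp_le_neg_log (hm n) (h0 n)
      ((hN n).iIndepFun_nodeVar hl₁ hlL) ht.le).trans hn
  have hb0 : Tendsto (fun t => (laplaceExponent ρ t + 1) / t) atTop (𝓝 0) := by
    simpa [add_div] using hΛ.levy.tendsto_laplaceExponent_div.add tendsto_inv_atTop_zero
  have hpart : ∀ κ ∈ Set.Ioo (0 : ℝ) 1, ∀ δ > 0, ∀ ε > 0,
      Tendsto (fun n => P {ω | δ ≤ (N n).totalVar l ω ∧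
        ε ≤ lowerShare κ fun j => (N n).nodeVar l j ω}) atTop (𝓝 0) ∧
      Tendsto (fun n => P {ω | δ ≤ (N n).totalVar l ω ∧
        ε ≤ lowerShare κ fun j => (N n).outNormSq l j ω}) atTop (𝓝 0) :=
    fun κ hκ δ hδ ε hε =>
      ⟨tendsto_measure_zero_of_measureReal
        (tendsto_measureReal_lowerShare hp hm h0 hb hb0 hκ.1 hδ hε),
      tendsto_measure_zero_of_measureReal
        (tendsto_measureReal_lowerShare_gaussian_mixture hp
          (fun n => (hN n).width_pos (l + 1) (by omega)) (pow_ne_zero 2 hσv.ne') hm h0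
          (fun n => (hN n).gauss_law l hlL)
          (fun n => (hN n).indepFun_nodeVar_gauss hl₁ hlL) hb hb0 hκ.1 hδ hε)⟩
  refine ⟨hpart, fun hcase => ?_⟩
  have hsmall : ∀ η : ℝ≥0∞, 0 < η → ∃ δ, 0 < δ ∧ ∀ᶠ n in atTop,
      P {ω | 0 < (N n).totalVar l ω ∧ (N n).totalVar l ω ≤ δ} ≤ η := by
    intro η hη
    rcases hcase with hρ | hlim
    · obtain ⟨θ, -, hθ, hθη⟩ := ENNReal.lt_iff_exists_real_btwn.1 hη
      obtain ⟨δ, hδ, hev⟩ := eventually_measure_le_le_of_laplace hconv hS hΛ hρ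
        (ENNReal.ofReal_pos.1 hθ)
      refine ⟨δ, hδ, hev.mono fun n hn => ?_⟩
      have h1 : P {ω | 0 < (N n).totalVar l ω ∧ (N n).totalVar l ω ≤ δ} ≤
          P {ω | (N n).totalVar l ω ≤ δ} := measure_mono fun ω hω => hω.2
      rw [← ofReal_measureReal (s := {ω | (N n).totalVar l ω ≤ δ})] at h1
      exact h1.trans ((ENNReal.ofReal_le_ofReal hn.le).trans hθη.le)
    · obtain ⟨δ, hlt, hδ⟩ :=
        ((hlim.eventually_lt_const hη).and self_mem_nhdsWithin).exists
      exact ⟨δ, hδ, (eventually_lt_of_limsup_lt hlt).mono fun n hn => hn.le⟩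
  have hzero : ∀ n, ∀ᵐ ω ∂P, 0 < (N n).totalVar l ω ∨ ∀ j, (N n).nodeVar l j ω = 0 := fun n => by
    filter_upwards [h0' n, hS n] with ω hω hSω
    refine hSω.lt_or_eq.imp_right fun h j => ?_
    exact (Finset.sum_eq_zero_iff_of_nonneg fun j _ => hω j).1 h.symm j (Finset.mem_univ j)
  refine ⟨fun κ hκ => ?_, fun κ hκ => ?_⟩
  · refine tendstoInMeasure_zero_of_restricted (fun n => ?_) (fun n => ?_) hsmall
      fun δ hδ ε hε => (hpart κ hκ δ hδ ε hε).1
    · filter_upwards [h0' n] with ω hω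
      exact lowerShare_nonneg κ hω
    · filter_upwards [hzero n] with ω hω
      exact hω.imp_right (lowerShare_of_forall_eq_zero κ)
  · refine tendstoInMeasure_zero_of_restricted (fun n => ?_) (fun n => ?_) hsmall
      fun δ hδ ε hε => (hpart κ hκ δ hδ ε hε).2
    · exact .of_forall fun ω => lowerShare_nonneg κ fun j =>
        Finset.sum_nonneg fun k _ => sq_nonneg _
    · filter_upwards [hzero n] with ω hω
      refine hω.imp_right fun h => lowerShare_of_forall_eq_zero κ fun j => ?_
      simp [MixtureNetwork.outNormSq, MixtureNetwork.weight, h j]
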